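/- Let $X=(X,d,\mu)$ be a metric space equipped with a positive complete Borel measure $\mu$ such that $0<\mu(B)<\infty$ for all balls $B\subset X$. Fix $x_0\in X$ and write $B(x,r)=\{y\in X: d(x,y)<r\}$ and $B_r=B(x_0,r)$. A Borel function $g\colon X\to[0,\infty]$ is an upper gradient of $f$ if $|f(\gamma(0))-f(\gamma(l_\gamma))|\le\int_\gamma g\,ds$ for all nonconstant compact rectifiable curves $\gamma\colon[0,l_\gamma]\to X$ parameterized by arc length. Assume that the following hold. (i) $\mu$ is globally doubling: there is $C>0$ such that $\mu(B(x,2r))\le C\mu(B(x,r))$ for all $x\in X$ and $r>0$. (ii) $X$ supports a global $q$-Poincaré inequality for some $1\le q<\infty$: there are $C>0$ and $\lambda\ge1$ such that for all balls $B=B(x,r)$, with $\lambda B=B(x,\lambda r)$, all integrable functions $f$ on $X$ and all upper gradients $g$ of $f$, $$\frac1{\mu(B)}\int_B|f-f_B|\,d\mu\le Cr\biggl(\frac1{\mu(\lambda B)}\int_{\lambda B}g^q\,d\mu\biggr)^{1/q},\qquad f_B=\frac1{\mu(B)}\int_B f\,d\mu.$$ (iii) There exists $a>0$ such that whenever $0<r<R\le2r$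 and $\delta=R-r$, for every $x\in B_R\setminus B_r$ there exist $x',x''\in X$ such that $B(x',a\delta)\subset B(x,2\delta)\cap B_r$ and $B(x'',a\delta)\subset B(x,2\delta)\setminus B_R$. Then the function $f(r):=\mu(B_r)$ is locally absolutely continuous on $(0,\infty)$, i.e. absolutely continuous on every compact interval $[s,t]\subset(0,\infty)$. Moreover, $\mu$ has the $1$-annular decay property at $x_0$, i.e. there is a constant $C$ such that $$\mu(B_R\setminus B_r)\le C\Bigl(1-\frac rR\Bigr)\mu(B_R)\qquad\text{for all }0<r<R,$$ if and only if there is a constant $M$ such that, for a.e. $\rho>0$, $f'(\rho)$ exists and $\rho f'(\rho)\le M f(\rho)$. -/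

import Mathlib

open MeasureTheory Set Metric
open scoped ENNReal

namespace MetricAD

variable {X : Type*} [MetricSpace X]

/-- `g` is an upper gradient of `f`: a Borel function `g : X → [0,∞]` such that
`|f (γ 0) - f (γ l)| ≤ ∫_γ g ds` for every nonconstant compact rectifiable curve, the curves being
parametrized by arc length as `γ : [0,l] → X` with `l > 0` (values of `γ` off `[0,l]` play no
role). -/
def IsUpperGradient (g : X → ℝ≥0∞) (f : X → ℝ) : Prop :=
  Measurable[borel X] g ∧
    ∀ (γ : ℝ → X) (l : ℝ), 0 < l → HasUnitSpeedOn γ (Icc 0 l) →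
      ENNReal.ofReal |f (γ 0) - f (γ l)| ≤ ∫⁻ t in Icc 0 l, g (γ t)

/-- The two-sided ball condition for all thin annuli centred at `x₀`. -/
def ThinAnnuliBallCondition (x₀ : X) : Prop :=
  ∃ a : ℝ, 0 < a ∧ ∀ r R : ℝ, 0 < r → r < R → R ≤ 2 * r →
    ∀ x ∈ ball x₀ R \ ball x₀ r,
      (∃ x' : X, ball x' (a * (R - r)) ⊆ ball x (2 * (R - r)) ∩ ball x₀ r) ∧
      (∃ x'' : X, ball x'' (a * (R - r)) ⊆ ball x (2 * (R - r)) \ ball x₀ R)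

variable [MeasurableSpace X]

/-- `μ` is globally doubling. -/
def GloballyDoubling (μ : Measure X) : Prop :=
  ∃ C : ℝ, 0 < C ∧ ∀ (x : X) (r : ℝ), 0 < r →
    μ (ball x (2 * r)) ≤ ENNReal.ofReal C * μ (ball x r)

/-- `(X, d, μ)` supports a global `q`-Poincaré inequality. -/
def SupportsGlobalPoincare (μ : Measure X) (q : ℝ) : Prop :=
  ∃ C Λ : ℝ, 0 < C ∧ 1 ≤ Λ ∧ ∀ (x : X) (r : ℝ), 0 < r →
    ∀ (f : X → ℝ) (g : X → ℝ≥0∞), Integrable f μ → IsUpperGradient g f →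
      ENNReal.ofReal (⨍ y in ball x r, |f y - ⨍ z in ball x r, f z ∂μ| ∂μ) ≤
        ENNReal.ofReal (C * r) * (⨍⁻ y in ball x (Λ * r), g y ^ q ∂μ) ^ (1 / q)

/-- `μ` has the `η`-annular decay property at `x`. -/
def AnnularDecayAt (μ : Measure X) (η : ℝ) (x : X) : Prop :=
  ∃ C : ℝ, ∀ r R : ℝ, 0 < r → r < R →
    μ.real (ball x R \ ball x r) ≤ C * (1 - r / R) ^ η * μ.real (ball x R)

/-- `f` is locally absolutely continuous on `(0,∞)`: absolutely continuous on every compact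
subinterval. -/
def LocallyACOnIoi (f : ℝ → ℝ) : Prop :=
  ∀ a b : ℝ, 0 < a → a ≤ b → AbsolutelyContinuousOnInterval f a b

end MetricAD

/-! The increments of `μ.real (ball x₀ r)` are the masses of intervals `[r, R)` under the image of
`μ` by the distance to `x₀`. So absolute continuity amounts to this: if `E ⊆ (0,∞)` is Lebesgue
null, the set `A` of points whose distance to `x₀` lies in `E` is `μ`-null.

Along a unit-speed curve the distance to `x₀` is 1-Lipschitz and gains nothing while its values lie
in `E`. Hence the indicator of `Aᶜ` is an upper gradient of any 1-Lipschitz function of the distance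
(`isUpperGradient_indicator_compl`). Let `x` be at distance `r` from `x₀`, let `δ ≤ r`, and truncate
the distance to `[r, r + δ]`. By the ball condition and doubling, the truncation takes both extreme
values on fixed proportions of `ball x (2δ)`, so its mean oscillation there is comparable to `δ`.
The Poincaré inequality then forces `Aᶜ` to fill a fixed proportion of a comparable ball
(`exists_mul_measure_ball_le_measure_ball_diff`). Thus `A` has no density points off `x₀`, and
Lebesgue's density theorem makes it null.

The equivalence is calculus: differentiate the decay inequality, or integrate the derivative bound.
-/

namespace MetricAD

open Filter Topology

/-! ### Doubling measures and Lebesgue density -/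

section Doubling

variable {X : Type*} [MetricSpace X] [MeasurableSpace X]

/-- A maximal `ε`-separated set is `ε`-dense. It is countable because the balls of radius `ε / 2`
about its points are disjoint and of positive measure, and `μ` is σ-finite. -/
theorem secondCountableTopology_of_ball_pos_lt_top [OpensMeasurableSpace X] (μ : Measure X)
    (hball : ∀ (x : X) (r : ℝ), 0 < r → 0 < μ (ball x r) ∧ μ (ball x r) < ∞) (x₀ : X) :
    SecondCountableTopology X := by
  have hσ : SigmaFinite μ := ⟨⟨{
    set := fun n => ball x₀ (n + 1)
    set_mem := fun _ => trivial
    finite := fun n => (hball x₀ (n + 1) (by positivity)).2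
    spanning := by
      refine eq_univ_of_forall fun y => mem_iUnion.2 ?_
      obtain ⟨n, hn⟩ := exists_nat_gt (dist y x₀)
      exact ⟨n, by rw [mem_ball]; linarith⟩ }⟩⟩
  refine Metric.secondCountable_of_almost_dense_set fun ε hε => ?_
  obtain ⟨s, hs⟩ := zorn_subset {s : Set X | s.Pairwise fun x y => ε < dist x y} (by
    intro c hc hchain
    refine ⟨⋃₀ c, ?_, fun t ht => subset_sUnion_of_mem ht⟩
    exact (pairwise_sUnion hchain.directedOn).2 fun t ht => hc ht)
  have hsep : s.Pairwise fun x y => ε < dist x y := hs.prop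
  refine ⟨s, ?_, fun x => ?_⟩
  · have hcount := Measure.countable_meas_pos_of_disjoint_iUnion (μ := μ)
      (As := fun y : s => ball (y : X) (ε / 2)) (fun y => isOpen_ball.measurableSet) (by
        intro y z hyz
        refine ball_disjoint_ball ?_
        have := hsep y.2 z.2 (fun h => hyz (Subtype.ext h))
        linarith)
    rw [eq_univ_of_forall (s := {i : s | 0 < μ (ball (i : X) (ε / 2))})
      (fun y => (hball y _ (half_pos hε)).1)] at hcount
    exact (countable_univ_iff.1 hcount)
  · by_contra! hx
    have hxs : x ∉ s := fun h => by
      have := hx x h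
      rw [dist_self] at this
      linarith
    have hins : (insert x s).Pairwise fun x y => ε < dist x y :=
      pairwise_insert.2
        ⟨hsep, fun y hy _ => ⟨hx y hy, by rw [dist_comm]; exact hx y hy⟩⟩
    exact hxs (hs.le_of_ge hins (subset_insert x s) (mem_insert x s))

theorem measure_ball_two_pow_mul_le {μ : Measure X} {D : ℝ≥0∞}
    (hD : ∀ (x : X) (r : ℝ), 0 < r → μ (ball x (2 * r)) ≤ D * μ (ball x r))
    (x : X) {r : ℝ} (hr : 0 < r) (k : ℕ) : μ (ball x (2 ^ k * r)) ≤ D ^ k * μ (ball x r) := by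
  induction k with
  | zero => simp
  | succ k ih =>
    calc μ (ball x (2 ^ (k + 1) * r)) = μ (ball x (2 * (2 ^ k * r))) := by ring_nf
      _ ≤ D * μ (ball x (2 ^ k * r)) := hD _ _ (by positivity)
      _ ≤ D * (D ^ k * μ (ball x r)) := by gcongr
      _ = D ^ (k + 1) * μ (ball x r) := by ring

/-- A Borel set whose complement occupies a fixed proportion of all small balls centred at the
points of the set is null, for a doubling measure. -/
theorem measure_eq_zero_of_compl_uniformly_dense [BorelSpace X] (μ : Measure X)
    (hball : ∀ (x : X) (r : ℝ), 0 < r → 0 < μ (ball x r) ∧ μ (ball x r) < ∞) (x₀ : X)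
    {D : ℝ≥0∞} (hDtop : D ≠ ∞)
    (hD : ∀ (x : X) (r : ℝ), 0 < r → μ (ball x (2 * r)) ≤ D * μ (ball x r))
    {A : Set X} (hA : MeasurableSet A) {c : ℝ≥0∞} (hc : c ≠ 0)
    (h : ∀ x ∈ A, ∃ s₀ > 0, ∀ s, 0 < s → s < s₀ → c * μ (ball x s) ≤ μ (ball x s \ A)) :
    μ A = 0 := by
  have : SecondCountableTopology X := secondCountableTopology_of_ball_pos_lt_top μ hball x₀
  have : IsLocallyFiniteMeasure μ :=
    ⟨fun x => ⟨ball x 1, ball_mem_nhds x one_pos, (hball x 1 one_pos).2⟩⟩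
  have hclosed : ∀ (x : X) (s : ℝ), 0 < s → μ (closedBall x s) ≤ D * μ (ball x s) :=
    fun x s hs => (measure_mono (closedBall_subset_ball (by linarith))).trans (hD x s hs)
  have : IsUnifLocDoublingMeasure μ := by
    refine ⟨⟨(D ^ 2).toNNReal, ?_⟩⟩
    filter_upwards [self_mem_nhdsWithin] with s hs x
    have hs : 0 < s := hs
    rw [ENNReal.coe_toNNReal (ENNReal.pow_ne_top hDtop)]
    calc μ (closedBall x (2 * s)) ≤ D * μ (ball x (2 * s)) := hclosed _ _ (by linarith)
      _ ≤ D * (D * μ (ball x s)) := by gcongr; exact hD x s hs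
      _ = D ^ 2 * μ (ball x s) := by ring
      _ ≤ D ^ 2 * μ (closedBall x s) := by gcongr; exact ball_subset_closedBall
  have hfalse : ∀ᵐ x ∂μ.restrict A, False := by
    filter_upwards [IsUnifLocDoublingMeasure.ae_tendsto_measure_inter_div μ A 0,
      ae_restrict_mem hA] with x hx hxA
    obtain ⟨s₀, hs₀, hs⟩ := h x hxA
    -- At a density point the proportion of `A` tends to 1, yet it leaves room for at least `c / D`;
    -- the factor `D` pays for passing from open to closed balls.
    have hlim := (hx (l := 𝓝[>] (0 : ℝ)) (fun _ => x) (fun s => s) tendsto_id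
      (by simp)).add_const (c / D)
    have hle : 1 + c / D ≤ 1 := by
      refine le_of_tendsto hlim ?_
      filter_upwards [Ioo_mem_nhdsGT hs₀] with s hs'
      have hpos : μ (closedBall x s) ≠ 0 :=
        ((hball x s hs'.1).1.trans_le (measure_mono ball_subset_closedBall)).ne'
      have htop : μ (closedBall x s) ≠ ∞ :=
        (((measure_mono (closedBall_subset_ball (by linarith [hs'.1]))).trans_lt
          (hball x (2 * s) (by linarith [hs'.1])).2)).ne
      have hcD : c / D * μ (closedBall x s) ≤ μ (closedBall x s \ A) := by
        calc c / D * μ (closedBall x s) = c * μ (closedBall x s) / D := by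
              rw [ENNReal.mul_div_right_comm]
          _ ≤ c * μ (ball x s) := by
              refine ENNReal.div_le_of_le_mul ?_
              calc c * μ (closedBall x s) ≤ c * (D * μ (ball x s)) := by
                    gcongr; exact hclosed x s hs'.1
                _ = _ := by ring
          _ ≤ μ (ball x s \ A) := hs s hs'.1 hs'.2
          _ ≤ _ := measure_mono (sdiff_subset_sdiff_left ball_subset_closedBall)
      have hcD' : c / D ≤ μ (closedBall x s \ A) / μ (closedBall x s) :=
        (ENNReal.le_div_iff_mul_le (Or.inl hpos) (Or.inl htop)).2 hcD
      calc _ ≤ μ (A ∩ closedBall x s) / μ (closedBall x s) +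
            μ (closedBall x s \ A) / μ (closedBall x s) := by gcongr
        _ = 1 := by
          rw [← ENNReal.add_div, inter_comm, measure_inter_add_sdiff _ hA,
            ENNReal.div_self hpos htop]
    have hz : c / D = 0 := by
      by_contra hne
      exact absurd hle (not_le.2 (ENNReal.lt_add_right ENNReal.one_ne_top hne))
    rcases ENNReal.div_eq_zero_iff.1 hz with h0 | h0
    · exact hc h0
    · exact hDtop h0
  have := ae_eq_bot.1 (eventually_false_iff_eq_bot.1 hfalse)
  exact Measure.restrict_eq_zero.1 this

end Doubling

/-! ### Upper gradients that ignore a null set of radii -/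

section UpperGradient

/-- A `1`-Lipschitz function on an interval spends at least time `|h 0 - h l|` off a null set. -/
theorem ofReal_abs_sub_le_volume_preimage_compl {h : ℝ → ℝ} (hh : LipschitzWith 1 h) {E : Set ℝ}
    (hE : volume E = 0) {l : ℝ} (hl : 0 ≤ l) :
    ENNReal.ofReal |h 0 - h l| ≤ volume (Icc 0 l ∩ h ⁻¹' Eᶜ) := by
  have hsub : uIcc (h 0) (h l) \ E ⊆ h '' (Icc 0 l ∩ h ⁻¹' Eᶜ) := by
    rintro y ⟨hy, hyE⟩
    have := intermediate_value_uIcc (hh.continuous.continuousOn (s := uIcc 0 l)) hy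
    rw [uIcc_of_le hl] at this
    obtain ⟨t, ht, rfl⟩ := this
    exact ⟨t, ⟨ht, hyE⟩, rfl⟩
  -- One-dimensional Hausdorff measure is Lebesgue measure, and a 1-Lipschitz map does not increase
  -- it.
  have himg := (hh.lipschitzOnWith (s := Icc 0 l ∩ h ⁻¹' Eᶜ)).hausdorffMeasure_image_le
    (zero_le_one (α := ℝ))
  rw [hausdorffMeasure_real, ENNReal.coe_one, ENNReal.one_rpow, one_mul] at himg
  calc ENNReal.ofReal |h 0 - h l| = volume (uIcc (h 0) (h l)) := by
        rw [Real.volume_interval, abs_sub_comm]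
    _ = volume (uIcc (h 0) (h l) \ E) := (measure_sdiff_null hE).symm
    _ ≤ _ := (measure_mono hsub).trans himg

variable {X : Type*} [MetricSpace X]

theorem lipschitzOnWith_one_of_hasUnitSpeedOn {γ : ℝ → X} {a b : ℝ}
    (hγ : HasUnitSpeedOn γ (Icc a b)) : LipschitzOnWith 1 γ (Icc a b) := by
  have key : ∀ x ∈ Icc a b, ∀ y ∈ Icc a b, x ≤ y → dist (γ x) (γ y) ≤ dist x y := by
    intro x hx y hy hxy
    have h1 := hγ hx hy
    have h2 := eVariationOn.edist_le γ (s := Icc a b ∩ Icc x y) ⟨hx, left_mem_Icc.2 hxy⟩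
      ⟨hy, right_mem_Icc.2 hxy⟩
    rw [h1, NNReal.coe_one, one_mul, edist_dist,
      ENNReal.ofReal_le_ofReal_iff (by linarith)] at h2
    rwa [Real.dist_eq, abs_sub_comm, abs_of_nonneg (by linarith)]
  refine LipschitzOnWith.of_dist_le_mul fun x hx y hy => ?_
  rw [NNReal.coe_one, one_mul]
  rcases le_total x y with hxy | hxy
  · exact key x hx y hy hxy
  · rw [dist_comm, dist_comm x]
    exact key y hy x hx hxy

/-- Level sets over a null set of radii may be discarded from the upper gradient `1` of a
`1`-Lipschitz function of the distance. -/
theorem isUpperGradient_indicator_compl {x₀ : X} {φ : ℝ → ℝ} (hφ : LipschitzWith 1 φ)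
    {E : Set ℝ} (hEm : MeasurableSet E) (hE : volume E = 0) :
    IsUpperGradient (((fun y : X => dist y x₀) ⁻¹' E)ᶜ.indicator fun _ => (1 : ℝ≥0∞))
      (fun y => φ (dist y x₀)) := by
  borelize X
  have hA : MeasurableSet ((fun y : X => dist y x₀) ⁻¹' E) :=
    (continuous_id.dist continuous_const).measurable hEm
  refine ⟨measurable_const.indicator hA.compl, fun γ l hl hγ => ?_⟩
  have hlip : LipschitzOnWith 1 (fun t => dist (γ t) x₀) (Icc 0 l) := by
    have := (LipschitzWith.dist_left x₀).comp_lipschitzOnWith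
      (lipschitzOnWith_one_of_hasUnitSpeedOn hγ)
    rwa [one_mul] at this
  -- Nothing is known about `γ` off `[0, l]`; the extension is continuous on the whole line, so its
  -- preimages of Borel sets are measurable.
  obtain ⟨h, hh, hEq⟩ := hlip.extend_real
  have h0 := hEq (left_mem_Icc.2 hl.le)
  have h1 := hEq (right_mem_Icc.2 hl.le)
  simp only at h0 h1
  have hT : MeasurableSet (Icc 0 l ∩ h ⁻¹' Eᶜ) :=
    measurableSet_Icc.inter (hh.continuous.measurable hEm.compl)
  calc ENNReal.ofReal |φ (dist (γ 0) x₀) - φ (dist (γ l) x₀)|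
      ≤ ENNReal.ofReal |h 0 - h l| := by
        rw [h0, h1]
        refine ENNReal.ofReal_le_ofReal ?_
        simpa [Real.dist_eq] using hφ.dist_le_mul (h 0) (h l)
    _ ≤ volume (Icc 0 l ∩ h ⁻¹' Eᶜ) := ofReal_abs_sub_le_volume_preimage_compl hh hE hl.le
    _ = ∫⁻ t in Icc 0 l ∩ h ⁻¹' Eᶜ, 1 := by simp
    _ = ∫⁻ t in Icc 0 l ∩ h ⁻¹' Eᶜ,
          ((fun y : X => dist y x₀) ⁻¹' E)ᶜ.indicator (fun _ => (1 : ℝ≥0∞)) (γ t) := by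
        refine setLIntegral_congr_fun hT fun t ht => ?_
        have hmem : γ t ∈ ((fun y : X => dist y x₀) ⁻¹' E)ᶜ := by
          have := hEq ht.1
          simp only at this
          rw [mem_compl_iff, mem_preimage, this]
          exact ht.2
        simp only [indicator_of_mem hmem]
    _ ≤ _ := lintegral_mono_set inter_subset_left

end UpperGradient

/-- Lower bound for the mean oscillation of a function taking two values on large parts of a
set. -/
theorem le_mul_setAverage_abs_sub {X : Type*} [MeasurableSpace X] {μ : Measure X}
    {B B₁ B₂ : Set X} (hB₁ : MeasurableSet B₁) (hB₂ : MeasurableSet B₂)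
    (h₁ : B₁ ⊆ B) (h₂ : B₂ ⊆ B) (hdisj : Disjoint B₁ B₂)
    (hpos : 0 < μ.real B) (hfin : μ B ≠ ∞) {K : ℝ} (hK : 0 < K)
    (hK₁ : μ.real B ≤ K * μ.real B₁) (hK₂ : μ.real B ≤ K * μ.real B₂)
    {u : X → ℝ} (hu : IntegrableOn u B μ) {a b : ℝ}
    (ha : ∀ y ∈ B₁, u y = a) (hb : ∀ y ∈ B₂, u y = b) (m : ℝ) :
    |a - b| ≤ K * ⨍ y in B, |u y - m| ∂μ := by
  have hi : IntegrableOn (fun y => |u y - m|) B μ :=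
    (hu.sub (integrableOn_const hfin)).abs
  have hint : μ.real B₁ * |a - m| + μ.real B₂ * |b - m| ≤ ∫ y in B, |u y - m| ∂μ := by
    have e₁ : ∫ y in B₁, |u y - m| ∂μ = μ.real B₁ * |a - m| := by
      rw [setIntegral_congr_fun hB₁ (g := fun _ => |a - m|) fun y hy => by
        simp only [ha y hy], setIntegral_const, smul_eq_mul]
    have e₂ : ∫ y in B₂, |u y - m| ∂μ = μ.real B₂ * |b - m| := by
      rw [setIntegral_congr_fun hB₂ (g := fun _ => |b - m|) fun y hy => by
        simp only [hb y hy], setIntegral_const, smul_eq_mul]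
    rw [← e₁, ← e₂, ← setIntegral_union hdisj hB₂ (hi.mono_set h₁) (hi.mono_set h₂)]
    exact setIntegral_mono_set hi (ae_of_all _ fun y => abs_nonneg _)
      (union_subset h₁ h₂).eventuallyLE
  rw [setAverage_eq, smul_eq_mul, mul_left_comm, ← div_eq_inv_mul, le_div_iff₀ hpos]
  have htri : |a - b| ≤ |a - m| + |b - m| := by
    rw [abs_sub_comm b m]; exact abs_sub_le a m b
  calc |a - b| * μ.real B ≤ (|a - m| + |b - m|) * μ.real B := by gcongr
    _ = |a - m| * μ.real B + |b - m| * μ.real B := by ring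
    _ ≤ |a - m| * (K * μ.real B₁) + |b - m| * (K * μ.real B₂) := by gcongr
    _ = K * (μ.real B₁ * |a - m| + μ.real B₂ * |b - m|) := by ring
    _ ≤ _ := by gcongr

/-- An indicator equals its own `q`-th power, so the right side of the Poincaré inequality becomes a
proportion of measure. -/
theorem setLAverage_indicator_one_rpow {X : Type*} [MeasurableSpace X] {μ : Measure X} {q : ℝ} (hq : 0 < q) {A : Set X}
    (hA : MeasurableSet A) (B : Set X) :
    ⨍⁻ y in B, (Aᶜ.indicator (fun _ => (1 : ℝ≥0∞)) y) ^ q ∂μ = μ (B \ A) / μ B := by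
  have : ∀ y, (Aᶜ.indicator (fun _ => (1 : ℝ≥0∞)) y) ^ q = Aᶜ.indicator (fun _ => 1) y := by
    intro y
    by_cases hy : y ∈ A <;> simp [hy, hq]
  simp_rw [this]
  rw [setLAverage_eq, lintegral_indicator_const hA.compl, one_mul,
    Measure.restrict_apply hA.compl, inter_comm, sdiff_eq]

/-! ### Level sets of the distance over null sets of radii -/

section LevelSets

variable {X : Type*} [MetricSpace X] [MeasurableSpace X] [OpensMeasurableSpace X]

/-- The complement of the level sets of the distance over a null set of radii occupies a fixed
proportion of all small balls. -/
theorem exists_mul_measure_ball_le_measure_ball_diff {μ : Measure X}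
    (hball : ∀ (x : X) (r : ℝ), 0 < r → 0 < μ (ball x r) ∧ μ (ball x r) < ∞)
    {x₀ : X} {q : ℝ} (hq : 1 ≤ q) {D : ℝ≥0∞} (hDtop : D ≠ ∞)
    (hD : ∀ (x : X) (r : ℝ), 0 < r → μ (ball x (2 * r)) ≤ D * μ (ball x r))
    (hpoincare : SupportsGlobalPoincare μ q) (hgeom : ThinAnnuliBallCondition x₀)
    {E : Set ℝ} (hEm : MeasurableSet E) (hE : volume E = 0) :
    ∃ c : ℝ≥0∞, c ≠ 0 ∧ ∃ Λ : ℝ, 0 < Λ ∧ ∀ x : X, ∀ δ : ℝ, 0 < δ → δ ≤ dist x x₀ →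
      c * μ (ball x (Λ * δ)) ≤ μ (ball x (Λ * δ) \ (fun y : X => dist y x₀) ⁻¹' E) := by
  obtain ⟨C, Λ, hC, hΛ, hP⟩ := hpoincare
  obtain ⟨a, ha, hann⟩ := hgeom
  -- For `z` in `ball x (2δ)`, this `k` gives `ball x (2δ) ⊆ ball z (4δ) ⊆ ball z (2 ^ k * (a *
  -- δ))`.
  obtain ⟨k, hk⟩ := pow_unbounded_of_one_lt (4 / a) (one_lt_two (α := ℝ))
  rw [div_lt_iff₀ ha] at hk
  set K : ℝ := (D ^ k).toReal + 1
  have hKpos : 0 < K := by positivity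
  have hA : MeasurableSet ((fun y : X => dist y x₀) ⁻¹' E) :=
    (continuous_id.dist continuous_const).measurable hEm
  have hq0 : 0 < q := by linarith
  -- If `p` is the proportion of `Aᶜ` in the enlarged ball, the oscillation bound and Poincaré give
  -- `δ / K ≤ 2Cδ * p ^ (1 / q)`.
  refine ⟨ENNReal.ofReal (1 / (2 * C * K)) ^ q, ?_, Λ * 2, by linarith, fun x δ hδ hδx => ?_⟩
  · have : 0 < 1 / (2 * C * K) := by positivity
    exact (ENNReal.rpow_pos (ENNReal.ofReal_pos.2 this) ENNReal.ofReal_ne_top).ne'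
  set r := dist x x₀
  have hx : x ∈ ball x₀ (r + δ) \ ball x₀ r := by
    simp only [Set.mem_sdiff, mem_ball]
    constructor <;> linarith
  obtain ⟨⟨x', hx'⟩, x'', hx''⟩ :=
    hann r (r + δ) (by linarith) (by linarith) (by linarith) x hx
  rw [add_sub_cancel_left] at hx' hx''
  have haδ : 0 < a * δ := by positivity
  have hcomp : ∀ z : X, ball z (a * δ) ⊆ ball x (2 * δ) →
      μ.real (ball x (2 * δ)) ≤ K * μ.real (ball z (a * δ)) := by
    intro z hz
    have hzx : dist z x < 2 * δ := hz (mem_ball_self haδ)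
    have hsub : ball x (2 * δ) ⊆ ball z (2 ^ k * (a * δ)) := by
      refine ball_subset_ball' ?_
      rw [dist_comm x z]
      nlinarith
    have hle : μ (ball x (2 * δ)) ≤ D ^ k * μ (ball z (a * δ)) :=
      (measure_mono hsub).trans (measure_ball_two_pow_mul_le hD z haδ k)
    have hle' := ENNReal.toReal_mono
      (ENNReal.mul_ne_top (ENNReal.pow_ne_top hDtop) (hball z _ haδ).2.ne) hle
    rw [ENNReal.toReal_mul] at hle'
    refine hle'.trans ?_
    rw [← measureReal_def]
    gcongr
    linarith
  -- Subtracting `r + δ` makes the function vanish outside `ball x₀ (r + δ)`, hence integrable on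
  -- all of `X`, as the Poincaré inequality requires.
  let φ : ℝ → ℝ := fun t => min (max t r) (r + δ) - (r + δ)
  have hφ : LipschitzWith 1 φ := by
    have h1 : LipschitzWith 1 fun t : ℝ => min (max t r) (r + δ) :=
      (LipschitzWith.id.max_const r).min_const (r + δ)
    refine LipschitzWith.of_dist_le_mul fun s t => ?_
    simpa [φ, Real.dist_eq] using h1.dist_le_mul s t
  have hφ0 : ∀ t, r + δ ≤ t → φ t = 0 := fun t ht => by
    simp only [φ]
    rw [min_eq_right (le_max_of_le_left ht), sub_self]
  have hφ1 : ∀ t, t ≤ r → φ t = -δ := fun t ht => by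
    simp only [φ]
    rw [max_eq_right ht, min_eq_left (by linarith)]
    ring
  have hφb : ∀ t, |φ t| ≤ δ := fun t => by
    have h1 : r ≤ min (max t r) (r + δ) := le_min (le_max_right _ _) (by linarith)
    have h2 : min (max t r) (r + δ) ≤ r + δ := min_le_right _ _
    simp only [φ]
    rw [abs_le]
    constructor <;> linarith
  set u : X → ℝ := fun y => φ (dist y x₀)
  have hucont : Continuous u := hφ.continuous.comp (continuous_id.dist continuous_const)
  have hint : Integrable u μ := by
    have hrδ : 0 < r + δ := by linarith
    have hon : IntegrableOn u (ball x₀ (r + δ)) μ :=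
      IntegrableOn.of_bound (hball x₀ _ hrδ).2 hucont.measurable.aestronglyMeasurable δ
        (ae_of_all _ fun y => hφb _)
    refine hon.integrable_of_forall_notMem_eq_zero fun y hy => hφ0 _ ?_
    simpa using hy
  have hB := hball x (2 * δ) (by linarith)
  have hlow : |(-δ) - 0| ≤ K * ⨍ y in ball x (2 * δ), |u y - ⨍ z in ball x (2 * δ), u z ∂μ| ∂μ :=
    le_mul_setAverage_abs_sub isOpen_ball.measurableSet isOpen_ball.measurableSet
      (hx'.trans inter_subset_left) (hx''.trans sdiff_subset)
      (disjoint_left.2 fun y hy hy' => (hx'' hy').2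
        (ball_subset_ball (by linarith) (hx' hy).2))
      (ENNReal.toReal_pos hB.1.ne' hB.2.ne) hB.2.ne hKpos
      (hcomp x' (hx'.trans inter_subset_left)) (hcomp x'' (hx''.trans sdiff_subset))
      hint.integrableOn
      (fun y hy => hφ1 _ (by simpa using (mem_ball.1 (hx' hy).2).le))
      (fun y hy => hφ0 _ (by simpa using (hx'' hy).2)) _
  rw [sub_zero, abs_neg, abs_of_pos hδ] at hlow
  have hPB := hP x (2 * δ) (by linarith) u _ hint
    (isUpperGradient_indicator_compl hφ hEm hE)
  rw [setLAverage_indicator_one_rpow hq0 hA, ← mul_assoc Λ 2 δ] at hPB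
  have hΛB := hball x (Λ * 2 * δ) (by positivity)
  set p := μ (ball x (Λ * 2 * δ) \ (fun y : X => dist y x₀) ⁻¹' E) / μ (ball x (Λ * 2 * δ))
  have h1 : ENNReal.ofReal (1 / (2 * C * K)) ≤ p ^ (1 / q) := by
    have h2 : ENNReal.ofReal (C * (2 * δ)) * ENNReal.ofReal (1 / (2 * C * K)) ≤
        ENNReal.ofReal (C * (2 * δ)) * p ^ (1 / q) := by
      refine le_trans ?_ hPB
      rw [← ENNReal.ofReal_mul (by positivity)]
      refine ENNReal.ofReal_le_ofReal ?_
      have : C * (2 * δ) * (1 / (2 * C * K)) = δ / K := by field_simp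
      rw [this, div_le_iff₀' hKpos]
      exact hlow
    exact (ENNReal.mul_le_mul_iff_right (ENNReal.ofReal_pos.2 (by positivity)).ne'
      ENNReal.ofReal_ne_top).1 h2
  have h3 : ENNReal.ofReal (1 / (2 * C * K)) ^ q ≤ p := by
    have := ENNReal.rpow_le_rpow h1 hq0.le
    rwa [← ENNReal.rpow_mul, one_div_mul_cancel hq0.ne', ENNReal.rpow_one] at this
  exact (ENNReal.le_div_iff_mul_le (Or.inl hΛB.1.ne') (Or.inl hΛB.2.ne)).1 h3

/-- The push-forward of `μ` under the distance from `x₀` is absolutely continuous away from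
`0`. -/
theorem map_dist_restrict_Ioi_absolutelyContinuous {μ : Measure X}
    (hball : ∀ (x : X) (r : ℝ), 0 < r → 0 < μ (ball x r) ∧ μ (ball x r) < ∞)
    {x₀ : X} {q : ℝ} (hq : 1 ≤ q) (hdoubling : GloballyDoubling μ)
    (hpoincare : SupportsGlobalPoincare μ q) (hgeom : ThinAnnuliBallCondition x₀) :
    (μ.map fun y => dist y x₀).restrict (Ioi 0) ≪ volume := by
  obtain ⟨C, -, hD⟩ := hdoubling
  have hd : Measurable fun y : X => dist y x₀ :=
    (continuous_id.dist continuous_const).measurable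
  refine Measure.AbsolutelyContinuous.mk fun s hs hs0 => ?_
  rw [Measure.restrict_apply hs, Measure.map_apply hd (hs.inter measurableSet_Ioi)]
  set E := s ∩ Ioi 0
  have hEm : MeasurableSet E := hs.inter measurableSet_Ioi
  have hE : volume E = 0 := measure_mono_null inter_subset_left hs0
  obtain ⟨c, hc, Λ, hΛ, h⟩ := exists_mul_measure_ball_le_measure_ball_diff hball hq
    ENNReal.ofReal_ne_top hD hpoincare hgeom hEm hE
  -- The σ-algebra may be larger than the Borel one (`μ` may be complete), while the density
  -- argument needs a Borel space; so `μ` is trimmed to the Borel sets.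
  have hle : borel X ≤ ‹MeasurableSpace X› := OpensMeasurableSpace.borel_le
  have htrim : ∀ t : Set X, MeasurableSet[borel X] t → μ.trim hle t = μ t :=
    fun t ht => trim_measurableSet_eq hle ht
  have hAm : MeasurableSet[borel X] ((fun y : X => dist y x₀) ⁻¹' E) :=
    (@Continuous.measurable X ℝ _ (borel X) (@BorelSpace.opensMeasurable X _ (borel X) (@BorelSpace.mk X _ (borel X) rfl))
      _ _ _ _ (continuous_id.dist continuous_const)) hEm
  have hbm : ∀ (x : X) (t : ℝ), MeasurableSet[borel X] (ball x t) := fun x t =>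
    MeasurableSpace.measurableSet_generateFrom isOpen_ball
  rw [← htrim _ hAm]
  refine @measure_eq_zero_of_compl_uniformly_dense X _ (borel X) (@BorelSpace.mk X _ (borel X) rfl) (μ.trim hle) ?_
    x₀ (ENNReal.ofReal C) ENNReal.ofReal_ne_top ?_ _ hAm c hc ?_
  · intro x t ht
    rw [htrim _ (hbm x t)]
    exact hball x t ht
  · intro x t ht
    rw [htrim _ (hbm x _), htrim _ (hbm x _)]
    exact hD x t ht
  · intro x hx
    have hx0 : 0 < dist x x₀ := hx.2
    refine ⟨Λ * dist x x₀, by positivity, fun t ht htx => ?_⟩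
    rw [htrim _ (hbm x t), htrim _ (MeasurableSet.diff (hbm x t) hAm)]
    have := h x (t / Λ) (by positivity) ((div_le_iff₀' hΛ).2 htx.le)
    rwa [mul_div_cancel₀ _ hΛ.ne'] at this

end LevelSets

/-! ### Absolute continuity and derivative bounds on the line -/

section RealLine

/-- A function whose increments are the masses of half-open intervals under a measure absolutely
continuous with respect to Lebesgue measure is absolutely continuous. -/
theorem absolutelyContinuousOnInterval_of_measure_Ico {ν : Measure ℝ} {f : ℝ → ℝ} {a b : ℝ}
    (hab : a ≤ b) (hfin : ν (Ico a b) ≠ ∞) (hν : ν.restrict (Ico a b) ≪ volume)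
    (hf : ∀ y ∈ Icc a b, f y = f a + ν.real (Ico a y)) :
    AbsolutelyContinuousOnInterval f a b := by
  have : IsFiniteMeasure (ν.restrict (Ico a b)) := ⟨by
    rw [Measure.restrict_apply_univ]; exact hfin.lt_top⟩
  set g : ℝ → ℝ := fun t => ((ν.restrict (Ico a b)).rnDeriv volume t).toReal
  have hg : Integrable g volume := Measure.integrable_toReal_rnDeriv
  have hac := (hg.intervalIntegrable (a := a) (b := b)
    ).absolutelyContinuousOnInterval_intervalIntegral (c := a) left_mem_uIcc
  have heq : ∀ y ∈ Icc a b, f y = f a + ∫ t in a..y, g t := by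
    intro y hy
    rw [hf y hy, intervalIntegral.integral_of_le hy.1, ← integral_Ico_eq_integral_Ioc,
      Measure.setIntegral_toReal_rnDeriv hν, measureReal_restrict_apply measurableSet_Ico,
      inter_eq_left.2 (Ico_subset_Ico_right hy.2)]
  rw [absolutelyContinuousOnInterval_iff] at hac ⊢
  intro ε hε
  obtain ⟨δ, hδ, h⟩ := hac ε hε
  refine ⟨δ, hδ, fun E hE hlen => ?_⟩
  have hsum := h E hE hlen
  convert hsum using 2 with i hi
  have hmem := hE.1 i hi
  rw [uIcc_of_le hab] at hmem
  rw [heq _ hmem.1, heq _ hmem.2, dist_add_left]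

/-- Divide the decay inequality by `ρ - r` and let `r` increase to `ρ`. -/
theorem mul_deriv_le_of_decay {f : ℝ → ℝ} {C ρ : ℝ} (hρ : 0 < ρ)
    (hd : DifferentiableAt ℝ f ρ)
    (h : ∀ r, 0 < r → r < ρ → f ρ - f r ≤ C * (1 - r / ρ) * f ρ) :
    ρ * deriv f ρ ≤ C * f ρ := by
  have hslope := hd.hasDerivAt.tendsto_slope.mono_left
    (nhdsWithin_mono ρ (fun r (hr : r ∈ Iio ρ) => (mem_Iio.1 hr).ne))
  have hle : deriv f ρ ≤ C * f ρ / ρ := by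
    refine le_of_tendsto hslope ?_
    filter_upwards [Ioo_mem_nhdsLT hρ] with r hr
    rw [slope_comm, slope_def_field, div_le_iff₀ (by linarith [hr.2])]
    calc f ρ - f r ≤ C * (1 - r / ρ) * f ρ := h r hr.1 hr.2
      _ = C * f ρ / ρ * (ρ - r) := by field_simp
  rwa [le_div_iff₀' hρ] at hle

/-- For `r < R / 2` the factor `1 - r / R` exceeds `1 / 2` and the bound is trivial. Otherwise
integrate `deriv f` over `[r, R]`, using monotonicity of `f` and `1 / r ≤ 2 / R`. -/
theorem decay_of_mul_deriv_le {f : ℝ → ℝ} (hmono : Monotone f) (hnonneg : ∀ r, 0 ≤ f r)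
    (hac : ∀ a b : ℝ, 0 < a → a ≤ b → AbsolutelyContinuousOnInterval f a b) {M : ℝ}
    (hM : ∀ᵐ ρ ∂(volume.restrict (Ioi (0 : ℝ))), ρ * deriv f ρ ≤ M * f ρ)
    {r R : ℝ} (hr : 0 < r) (hrR : r < R) :
    f R - f r ≤ max 2 (2 * M) * (1 - r / R) * f R := by
  have hR : 0 < R := hr.trans hrR
  have hfrac : 0 < 1 - r / R := by rw [sub_pos, div_lt_one hR]; exact hrR
  rcases lt_or_ge r (R / 2) with hsmall | hlarge
  · have hhalf : 1 ≤ 2 * (1 - r / R) := by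
      have : r / R < 1 / 2 := by rw [div_lt_iff₀ hR]; linarith
      linarith
    calc f R - f r ≤ 1 * f R := by linarith [hnonneg r]
      _ ≤ 2 * (1 - r / R) * f R := by gcongr; exact hnonneg R
      _ ≤ _ := by gcongr; exacts [hnonneg R, le_max_left _ _]
  · have hAC := hac r R hr hrR.le
    -- `M` may be negative; a nonnegative constant is needed to replace `f t` by `f R`.
    set N := max 0 M
    have hbound : ∀ᵐ t ∂(volume.restrict (Icc r R)), deriv f t ≤ N * f R / r := by
      have hsub : Icc r R ⊆ Ioi 0 := fun t ht => hr.trans_le ht.1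
      filter_upwards [ae_restrict_of_ae_restrict_of_subset hsub hM,
        ae_restrict_mem measurableSet_Icc] with t ht htm
      have hd0 : 0 ≤ deriv f t := hmono.deriv_nonneg
      rw [le_div_iff₀' hr]
      calc r * deriv f t ≤ t * deriv f t := by gcongr; exact htm.1
        _ ≤ M * f t := ht
        _ ≤ N * f t := by gcongr; exacts [hnonneg t, le_max_right _ _]
        _ ≤ N * f R := mul_le_mul_of_nonneg_left (hmono htm.2) (le_max_left _ _)
    have hint : ∫ t in r..R, deriv f t ≤ ∫ _ in r..R, N * f R / r :=
      intervalIntegral.integral_mono_ae_restrict hrR.le hAC.intervalIntegrable_deriv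
        intervalIntegrable_const hbound
    rw [hAC.integral_deriv_eq_sub, intervalIntegral.integral_const, smul_eq_mul] at hint
    have hN : 0 ≤ N := le_max_left _ _
    calc f R - f r ≤ (R - r) * (N * f R / r) := hint
      _ ≤ (R - r) * (N * f R / (R / 2)) := by
          have := hnonneg R
          have : 0 ≤ R - r := by linarith
          gcongr
      _ = 2 * N * (1 - r / R) * f R := by field_simp
      _ ≤ _ := by
          have : 2 * N ≤ max 2 (2 * M) := by
            rcases le_total M 0 with h | h
            · simp only [N, max_eq_left h, mul_zero]
              exact le_max_of_le_left zero_le_two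
            · simp only [N, max_eq_right h]
              exact le_max_right _ _
          gcongr
          exact hnonneg R

end RealLine

end MetricAD

theorem mainTheorem12 {X : Type*} [MetricSpace X] [MeasurableSpace X] [OpensMeasurableSpace X]
    (μ : Measure X)
    (hball : ∀ (x : X) (r : ℝ), 0 < r → 0 < μ (ball x r) ∧ μ (ball x r) < ∞)
    (x₀ : X) (q : ℝ) (hq : 1 ≤ q)
    (hdoubling : MetricAD.GloballyDoubling μ)
    (hpoincare : MetricAD.SupportsGlobalPoincare μ q)
    (hgeom : MetricAD.ThinAnnuliBallCondition x₀) :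
    MetricAD.LocallyACOnIoi (fun r : ℝ => μ.real (ball x₀ r)) ∧
    (MetricAD.AnnularDecayAt μ 1 x₀ ↔
      ∃ M : ℝ, ∀ᵐ ρ ∂(volume.restrict (Ioi (0 : ℝ))),
        DifferentiableAt ℝ (fun r : ℝ => μ.real (ball x₀ r)) ρ ∧
          ρ * deriv (fun r : ℝ => μ.real (ball x₀ r)) ρ ≤ M * μ.real (ball x₀ ρ)) := by
  have hfin : ∀ r : ℝ, μ (ball x₀ r) ≠ ∞ := fun r => by
    rcases lt_or_ge 0 r with hr | hr
    · exact (hball x₀ r hr).2.ne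
    · simp [ball_eq_empty.2 hr]
  have hmono : Monotone fun r : ℝ => μ.real (ball x₀ r) := fun r R hrR =>
    measureReal_mono (ball_subset_ball hrR) (hfin R)
  have hdiff : ∀ r R : ℝ, r ≤ R →
      μ.real (ball x₀ R \ ball x₀ r) = μ.real (ball x₀ R) - μ.real (ball x₀ r) :=
    fun r R hrR => measureReal_sdiff (ball_subset_ball hrR) isOpen_ball.measurableSet (hfin R)
  have hAC : MetricAD.LocallyACOnIoi (fun r : ℝ => μ.real (ball x₀ r)) := by
    intro a b ha hab
    have hd : Measurable fun y : X => dist y x₀ :=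
      (continuous_id.dist continuous_const).measurable
    have hpre : ∀ y : ℝ, (fun y : X => dist y x₀) ⁻¹' Ico a y = ball x₀ y \ ball x₀ a := by
      intro y
      ext z
      simp [and_comm]
    refine MetricAD.absolutelyContinuousOnInterval_of_measure_Ico
      (ν := μ.map fun y => dist y x₀) hab ?_ ?_ ?_
    · rw [Measure.map_apply hd measurableSet_Ico, hpre]
      exact measure_ne_top_of_subset sdiff_subset (hfin b)
    · exact (Measure.absolutelyContinuous_of_le (Measure.restrict_mono_set _
        fun t ht => ha.trans_le ht.1)).trans
        (MetricAD.map_dist_restrict_Ioi_absolutelyContinuous hball hq hdoubling hpoincare hgeom)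
    · intro y hy
      rw [measureReal_def (μ.map _), Measure.map_apply hd measurableSet_Ico, hpre,
        ← measureReal_def, hdiff a y hy.1]
      ring
  refine ⟨hAC, fun ⟨C, hC⟩ => ⟨C, ?_⟩, fun ⟨M, hM⟩ => ⟨max 2 (2 * M), fun r R hr hrR => ?_⟩⟩
  -- Differentiability almost everywhere comes from monotonicity alone.
  · filter_upwards [ae_restrict_of_ae hmono.ae_differentiableAt,
      ae_restrict_mem measurableSet_Ioi] with ρ hρd hρ
    refine ⟨hρd, MetricAD.mul_deriv_le_of_decay hρ hρd fun r hr hrρ => ?_⟩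
    have := hC r ρ hr hrρ
    rwa [Real.rpow_one, hdiff r ρ hrρ.le] at this
  · rw [Real.rpow_one, hdiff r R hrR.le]
    exact MetricAD.decay_of_mul_deriv_le hmono (fun _ => measureReal_nonneg) hAC
      (hM.mono fun _ h => h.2) hr hrR
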